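/- Let $V$ be an $n$-dimensional vector space over a finite field $\mathbb{F}_q$, and let $X_V$ be the order complex of the poset of linear subspaces $0 \neq U \subsetneq V$, ordered by inclusion: its $p$-simplices are the flags $\sigma = [U_1 \subsetneq \cdots \subsetneq U_{p+1}]$ of such subspaces ($p \geq -1$, the empty flag being the only simplex of dimension $-1$). Let $\mathfrak{g}$ be the local system on $X_V$ with $\mathfrak{g}(U_1 \subsetneq \cdots \subsetneq U_{\ell}) = U_1$ and $\mathfrak{g}(\emptyset) = V$, whose connecting maps $\mathfrak g(\tau)\to\mathfrak g(\sigma)$, $\sigma\subset\tau$, are the inclusions, and let $\wedge^k \mathfrak{g}$ be its $k$-th exterior power. A $p$-chain with coefficients in $\wedge^k\mathfrak{g}$ is a formal sum $c = \sum_{\sigma} c(\sigma)\,\sigma$ over the $p$-simplices $\sigma$ with $c(\sigma) \in \wedge^k \mathfrak{g}(\sigma)$; its support is $\mathrm{supp}(c) = \{\sigma : c(\sigma) \neq 0\}$. The boundary of $c$ is $\partial_p c = \sum_{\sigma} \sum_{i=1}^{p+1} (-1)^{i+1} c(\sigma)\, \sigma_i$, where $\sigma_i$ is obtained from $\sigma$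 by deleting $U_i$ and $c(\sigma)$ is mapped to $\wedge^k\mathfrak{g}(\sigma_i)$ by the connecting map. Let $1 \leq k \leq n-1$ and let $\mathcal{D}^k(V) = \tilde H_{n-k-1}(X_V; \wedge^k \mathfrak{g})$ be the homology in degree $n-k-1$ of this complex (which includes degree $-1$). Then every element $w$ of $\mathcal{D}^k(V)$ is represented by exactly one cycle, whose support is denoted by $\mathrm{supp}(w)$, and $$\min\big\{\, |\mathrm{supp}(w)| : 0 \neq w \in \mathcal{D}^k(V) \,\big\} = \frac{(n-k+2)!}{2}.$$ -/

import Mathlib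

noncomputable section

namespace TwistedBuilding

universe u v w

section LocalSystems

variable (R : Type u) [CommRing R] (P : Type v) [PartialOrder P]

/-- The order complex of a poset `P`: its simplices are the finite chains of `P`,
the empty chain (the simplex of dimension `-1`) included. -/
def OrderComplex : Type v := {σ : Finset P // IsChain (· ≤ ·) (σ : Set P)}

/-- The simplices of dimension `p ≥ -1`: the chains with `p + 1` elements. -/
def Simplex (p : ℤ) : Type v := {σ : OrderComplex P // (σ.1.card : ℤ) = p + 1}

instance [Finite P] : Finite (OrderComplex P) := inferInstanceAs (Finite {_σ : Finset P // _})

instance [Finite P] (p : ℤ) : Finite (Simplex P p) :=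
  inferInstanceAs (Finite {_σ : OrderComplex P // _})

instance [Finite P] (p : ℤ) : Fintype (Simplex P p) := Fintype.ofFinite _

/-- A local system of `R`-modules on the order complex of `P`; `map` is the connecting
homomorphism `ρ_σ^τ : F(τ) → F(σ)` for `σ ⊆ τ`. -/
structure LocalSystem where
  obj : OrderComplex P → Type w
  [addCommGroup : ∀ σ, AddCommGroup (obj σ)]
  [module : ∀ σ, Module R (obj σ)]
  map : ∀ {σ τ : OrderComplex P}, σ.1 ⊆ τ.1 → (obj τ →ₗ[R] obj σ)
  map_id : ∀ σ : OrderComplex P, map (Finset.Subset.refl σ.1) = LinearMap.id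
  map_comp : ∀ {η σ τ : OrderComplex P} (h : η.1 ⊆ σ.1) (h' : σ.1 ⊆ τ.1),
    map h ∘ₗ map h' = map (h.trans h')

end LocalSystems

attribute [instance] LocalSystem.addCommGroup LocalSystem.module

namespace LocalSystem

variable {R : Type u} [CommRing R] {P : Type v} [PartialOrder P]

/-- The `k`-th exterior power of a local system, taken simplex by simplex. -/
def extPower (F : LocalSystem.{u, v, w} R P) (k : ℕ) : LocalSystem.{u, v, max u w} R P where
  obj σ := ⋀[R]^k (F.obj σ)
  map h := exteriorPower.map k (F.map h)
  map_id σ := by rw [F.map_id, exteriorPower.map_id]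
  map_comp h h' := by rw [← F.map_comp h h', exteriorPower.map_comp]

variable (F : LocalSystem.{u, v, w} R P)

/-- The `F`-twisted chains of dimension `p`, as functions `σ ↦ c(σ) ∈ F(σ)` on the `p`-simplices
(used only for finite `P`, where these are the same as formal linear combinations). -/
abbrev Chain (p : ℤ) : Type (max v w) := (σ : Simplex P p) → F.obj σ.1

/-- The support of a twisted chain. -/
def supp {F : LocalSystem.{u, v, w} R P} {p : ℤ} (c : F.Chain p) : Set (Simplex P p) :=
  {σ | c σ ≠ 0}

open Classical in
/-- The boundary map from `p`-chains to `r`-chains, to be used for `r = p - 1` (it is zero for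
every other `r`). The face of `τ` opposite to its vertex `s` enters with the sign `(-1)^j`, where
`j` is the number of vertices of `τ` below `s`; so `s` is the `(j+1)`-st vertex of `τ` and
`(-1)^j = (-1)^((j+1)+1)`. -/
def boundary [Finite P] (p r : ℤ) : F.Chain p →ₗ[R] F.Chain r where
  toFun c σ := ∑ τ : Simplex P p, ∑ s ∈ τ.1.1,
    if h : σ.1.1 = τ.1.1.erase s then
      ((-1 : R) ^ (τ.1.1.filter (· < s)).card) •
        F.map (h.trans_subset (Finset.erase_subset s τ.1.1)) (c τ)
    else 0
  map_add' c d := by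
    funext σ
    simp only [Pi.add_apply, ← Finset.sum_add_distrib]
    refine Finset.sum_congr rfl fun τ _ => Finset.sum_congr rfl fun s _ => ?_
    split_ifs <;> simp
  map_smul' a c := by
    funext σ
    simp only [Pi.smul_apply, RingHom.id_apply, Finset.smul_sum]
    refine Finset.sum_congr rfl fun τ _ => Finset.sum_congr rfl fun s _ => ?_
    split_ifs
    · rw [map_smul, smul_comm]
    · simp

/-- The `p`-cycles of the reduced chain complex. -/
abbrev cycles [Finite P] (p : ℤ) : Submodule R (F.Chain p) :=
  LinearMap.ker (F.boundary p (p - 1))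

/-- The `p`-boundaries of the reduced chain complex. -/
abbrev boundaries [Finite P] (p : ℤ) : Submodule R (F.Chain p) :=
  LinearMap.range (F.boundary (p + 1) p)

/-- The reduced homology of the order complex of `P` in degree `p` with coefficients in `F`:
cycles modulo boundaries. -/
abbrev reducedHomology [Finite P] (p : ℤ) : Type (max v w) :=
  F.cycles p ⧸ (F.boundaries p).submoduleOf (F.cycles p)

/-- The homology class of a cycle. -/
def homologyClass [Finite P] {p : ℤ} (z : F.cycles p) : F.reducedHomology p :=
  Submodule.Quotient.mk z

end LocalSystem

section Building

variable (K : Type u) (V : Type v) [Field K] [AddCommGroup V] [Module K V]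

/-- The vertices of the spherical building `X_V`: the subspaces `0 ≠ U ⊊ V`, ordered by inclusion.
The building `X_V` is the order complex of this poset. -/
abbrev Vertex : Type v := {U : Submodule K V // U ≠ ⊥ ∧ U ≠ ⊤}

instance [Finite K] [FiniteDimensional K V] : Finite (Vertex K V) :=
  haveI : Finite V := Module.finite_of_finite K
  haveI : Finite (Submodule K V) := Finite.of_injective _ SetLike.coe_injective
  inferInstance

variable {K V}

/-- The intersection of the members of a flag; it is the smallest member `U₁` of a nonempty flag
`U₁ ⊊ ⋯ ⊊ U_ℓ` (`bottom_eq`) and all of `V` for the empty flag (`bottom_empty`). -/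
def bottom (σ : OrderComplex (Vertex K V)) : Submodule K V := σ.1.inf Subtype.val

theorem bottom_eq (σ : OrderComplex (Vertex K V)) (U : Vertex K V) (hU : U ∈ σ.1)
    (hmin : ∀ W ∈ σ.1, U ≤ W) : bottom σ = U.1 :=
  le_antisymm (Finset.inf_le (f := Subtype.val) hU) (Finset.le_inf fun W hW => hmin W hW)

theorem bottom_empty (σ : OrderComplex (Vertex K V)) (h : σ.1 = ∅) : bottom σ = ⊤ := by
  simp [bottom, h]

variable (K V)

/-- The local system `𝔤` on `X_V`: `𝔤(U₁ ⊊ ⋯ ⊊ U_ℓ) = U₁` and `𝔤(∅) = V`, with the inclusions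
as connecting homomorphisms. -/
def lusztig : LocalSystem.{u, v, v} K (Vertex K V) where
  obj σ := bottom σ
  map h := Submodule.inclusion (Finset.inf_mono h)
  map_id _ := rfl
  map_comp _ _ := rfl

/-- The dimension `n - k - 1` of the simplices carrying `𝒟^k(V)`, where `n = dim V`. -/
abbrev degD (k : ℕ) : ℤ := (Module.finrank K V : ℤ) - k - 1

/-- `𝒟^k(V) = H̃_{n-k-1}(X_V; ⋀^k 𝔤)`, where `n = dim V`. -/
abbrev D [Finite K] [FiniteDimensional K V] (k : ℕ) : Type (max u v) :=
  ((lusztig K V).extPower k).reducedHomology (degD K V k)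

/-- The cycles representing the elements of `𝒟^k(V)`. -/
abbrev cyclesD [Finite K] [FiniteDimensional K V] (k : ℕ) :
    Submodule K (((lusztig K V).extPower k).Chain (degD K V k)) :=
  ((lusztig K V).extPower k).cycles (degD K V k)

end Building

end TwistedBuilding

end

/-! Write `m = n - k`. A flag with more than `m` members has a lowest member of dimension below `k`,
where `⋀ᵏ` vanishes. So there are no nonzero chains one degree up, and homology classes are cycles.
A flag in the support of a cycle has members of dimensions exactly `k, …, n - 1`.

Lower bound: the cycle condition at the face missing one member of such a flag forces another flag
of the support through that face. For the lowest member it forces two more, because distinct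
`k`-dimensional subspaces give independent lines in `⋀ᵏ V`
(`exteriorPower_map_subtype_add_ne_zero`). Thus, with everything above level `j` fixed, at least `j
+ 3` subspaces occur at level `j` (`le_card_image_agreeAbove`), and the product `3 · 4 ⋯ (m + 2)` is
`(m + 2)! / 2`.

Sharpness: modulo the span of `k - 1` vectors `z`, take `m + 2` points in general position. An
ordering of the points gives the flag spanned by `z` and the differences of its first `2, …, m + 1`
points; interchanging the first two points gives the same flag. The signed sum over all orderings of
(first point) ∧ `z` puts on each flag the wedge of a difference of two points, which lies in the
lowest member. Boundary terms cancel under adjacent transpositions that fix the first point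
(`sum_term_erase_eq_zero`). -/

noncomputable section

namespace TwistedBuilding

open Module

/-! ### Counting saturated chains with exchange properties -/

section Combinatorics

variable {ι L : Type*}

open Classical in
/-- The members of a family of chains `g σ 0 ⋖ g σ 1 ⋖ ⋯` that agree with `σ` from level `j` on. -/
def agreeAbove (S : Finset ι) (g : ι → ℕ → L) (σ : ι) (j : ℕ) : Finset ι :=
  S.filter fun τ => ∀ t, j ≤ t → g τ t = g σ t

theorem mem_agreeAbove {S : Finset ι} {g : ι → ℕ → L} {σ τ : ι} {j : ℕ} :
    τ ∈ agreeAbove S g σ j ↔ τ ∈ S ∧ ∀ t, j ≤ t → g τ t = g σ t := by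
  simp [agreeAbove]

variable [SemilatticeInf L]

open Classical in
-- Each lower element `W` is the meet of `g σ (j + 1)` with some other element of level `j + 1`, so
-- there is strictly more choice one level up.
theorem le_card_image_agreeAbove {S : Finset ι} {g : ι → ℕ → L} {m : ℕ}
    (hcov : ∀ σ ∈ S, ∀ j < m, g σ j ⋖ g σ (j + 1))
    (hmid : ∀ σ ∈ S, ∀ j, 0 < j → j < m → ∃ τ ∈ S, g τ j ≠ g σ j ∧ ∀ t, t ≠ j → g τ t = g σ t)
    (hbot : ∀ σ ∈ S, ∃ τ₁ ∈ S, ∃ τ₂ ∈ S, g τ₁ 0 ≠ g σ 0 ∧ g τ₂ 0 ≠ g σ 0 ∧ g τ₁ 0 ≠ g τ₂ 0 ∧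
      (∀ t, t ≠ 0 → g τ₁ t = g σ t) ∧ ∀ t, t ≠ 0 → g τ₂ t = g σ t)
    (j : ℕ) (hj : j < m) (σ : ι) (hσ : σ ∈ S) :
    j + 3 ≤ ((agreeAbove S g σ (j + 1)).image (g · j)).card := by
  induction j with
  | zero =>
    obtain ⟨τ₁, h₁, τ₂, h₂, n₁, n₂, n₁₂, e₁, e₂⟩ := hbot σ hσ
    have hsub : ({g σ 0, g τ₁ 0, g τ₂ 0} : Finset L) ⊆
        (agreeAbove S g σ (0 + 1)).image (g · 0) := by
      intro x hx
      simp only [Finset.mem_insert, Finset.mem_singleton] at hx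
      rw [Finset.mem_image]
      rcases hx with rfl | rfl | rfl
      · exact ⟨σ, mem_agreeAbove.2 ⟨hσ, fun _ _ => rfl⟩, rfl⟩
      · exact ⟨τ₁, mem_agreeAbove.2 ⟨h₁, fun t ht => e₁ t (by omega)⟩, rfl⟩
      · exact ⟨τ₂, mem_agreeAbove.2 ⟨h₂, fun t ht => e₂ t (by omega)⟩, rfl⟩
    have h3 : ({g σ 0, g τ₁ 0, g τ₂ 0} : Finset L).card = 3 :=
      Finset.card_eq_three.2 ⟨_, _, _, n₁.symm, n₂.symm, n₁₂, rfl⟩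
    rw [zero_add, ← h3]
    exact Finset.card_le_card hsub
  | succ j ih =>
    have ih := ih (by omega)
    -- Exchange level `j + 1` in a chain through `W`: the old and new elements are distinct covers
    -- of `W`, so their meet is `W`. Hence `W ↦ H` is injective and misses `g σ (j + 1)`.
    have key : ∀ W ∈ (agreeAbove S g σ (j + 1)).image (g · j), ∃ H,
        H ∈ ((agreeAbove S g σ (j + 1 + 1)).image (g · (j + 1))).erase (g σ (j + 1)) ∧
        W = g σ (j + 1) ⊓ H := by
      intro W hW
      obtain ⟨τ, hτ, rfl⟩ := Finset.mem_image.1 hW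
      obtain ⟨hτS, hτ⟩ := mem_agreeAbove.1 hτ
      obtain ⟨τ', hτ'S, hne, heq⟩ := hmid τ hτS (j + 1) (by omega) hj
      rw [hτ _ le_rfl] at hne
      refine ⟨g τ' (j + 1), Finset.mem_erase.2 ⟨hne, Finset.mem_image.2 ⟨τ', ?_, rfl⟩⟩, ?_⟩
      · exact mem_agreeAbove.2 ⟨hτ'S, fun t ht => (heq t (by omega)).trans (hτ t (by omega))⟩
      · have c₁ : g τ j ⋖ g σ (j + 1) := hτ _ le_rfl ▸ hcov τ hτS j (by omega)
        have c₂ : g τ j ⋖ g τ' (j + 1) := heq j (by omega) ▸ hcov τ' hτ'S j (by omega)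
        by_contra hW
        have hlt : g τ j < g σ (j + 1) ⊓ g τ' (j + 1) := lt_of_le_of_ne (le_inf c₁.le c₂.le) hW
        have e₁ : g σ (j + 1) ⊓ g τ' (j + 1) = g σ (j + 1) :=
          (lt_or_eq_of_le inf_le_left).resolve_left (c₁.2 hlt)
        have e₂ : g σ (j + 1) ⊓ g τ' (j + 1) = g τ' (j + 1) :=
          (lt_or_eq_of_le inf_le_right).resolve_left (c₂.2 hlt)
        exact hne (e₂.symm.trans e₁)
    choose! H hH hinf using key
    have hle := Finset.card_le_card_of_injOn H hH fun W hW W' hW' h => by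
      rw [hinf W hW, hinf W' hW', h]
    have hmem : g σ (j + 1) ∈ (agreeAbove S g σ (j + 1 + 1)).image (g · (j + 1)) :=
      Finset.mem_image.2 ⟨σ, mem_agreeAbove.2 ⟨hσ, fun _ _ => rfl⟩, rfl⟩
    have := Finset.card_erase_add_one hmem
    omega

/-- Fibre the chains over their highest free element: the previous lemma counts the fibres, and
induction bounds each of them. -/
theorem factorial_le_two_mul_card_agreeAbove {S : Finset ι} {g : ι → ℕ → L} {m : ℕ}
    (hcov : ∀ σ ∈ S, ∀ j < m, g σ j ⋖ g σ (j + 1))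
    (hmid : ∀ σ ∈ S, ∀ j, 0 < j → j < m → ∃ τ ∈ S, g τ j ≠ g σ j ∧ ∀ t, t ≠ j → g τ t = g σ t)
    (hbot : ∀ σ ∈ S, ∃ τ₁ ∈ S, ∃ τ₂ ∈ S, g τ₁ 0 ≠ g σ 0 ∧ g τ₂ 0 ≠ g σ 0 ∧ g τ₁ 0 ≠ g τ₂ 0 ∧
      (∀ t, t ≠ 0 → g τ₁ t = g σ t) ∧ ∀ t, t ≠ 0 → g τ₂ t = g σ t)
    (j : ℕ) (hj : j < m) (σ : ι) (hσ : σ ∈ S) :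
    (j + 3).factorial ≤ 2 * (agreeAbove S g σ (j + 1)).card := by
  classical
  induction j generalizing σ with
  | zero =>
    have := le_card_image_agreeAbove hcov hmid hbot 0 hj σ hσ
    have h' := Finset.card_image_le (s := agreeAbove S g σ (0 + 1)) (f := (g · 0))
    simp only [Nat.factorial]
    omega
  | succ j ih =>
    have hA := le_card_image_agreeAbove hcov hmid hbot (j + 1) hj σ hσ
    rw [Finset.card_eq_sum_card_image (g · (j + 1)) (agreeAbove S g σ (j + 1 + 1)), Finset.mul_sum]
    refine le_trans ?_ (Finset.card_nsmul_le_sum _ _ (j + 3).factorial ?_)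
    · rw [show j + 1 + 3 = (j + 3) + 1 by ring, Nat.factorial_succ, smul_eq_mul]
      exact Nat.mul_le_mul_right _ (by omega)
    · intro H hH
      obtain ⟨τ, hτ, rfl⟩ := Finset.mem_image.1 hH
      obtain ⟨hτS, hτ⟩ := mem_agreeAbove.1 hτ
      refine (ih (by omega) τ hτS).trans (Nat.mul_le_mul_left _ (Finset.card_le_card ?_))
      intro ρ hρ
      obtain ⟨hρS, hρ⟩ := mem_agreeAbove.1 hρ
      exact Finset.mem_filter.2 ⟨mem_agreeAbove.2 ⟨hρS, fun t ht =>
        (hρ t (by omega)).trans (hτ t ht)⟩, hρ _ le_rfl⟩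

/-- A family of saturated chains of length `m` with a common top, in which every member other than
the lowest can be exchanged, and the lowest member in two ways, has at least `(m + 2)! / 2`
elements. -/
theorem factorial_le_two_mul_card {S : Finset ι} {g : ι → ℕ → L} {m : ℕ} (hm : 0 < m)
    (hS : S.Nonempty)
    (hcov : ∀ σ ∈ S, ∀ j < m, g σ j ⋖ g σ (j + 1))
    (hmid : ∀ σ ∈ S, ∀ j, 0 < j → j < m → ∃ τ ∈ S, g τ j ≠ g σ j ∧ ∀ t, t ≠ j → g τ t = g σ t)
    (hbot : ∀ σ ∈ S, ∃ τ₁ ∈ S, ∃ τ₂ ∈ S, g τ₁ 0 ≠ g σ 0 ∧ g τ₂ 0 ≠ g σ 0 ∧ g τ₁ 0 ≠ g τ₂ 0 ∧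
      (∀ t, t ≠ 0 → g τ₁ t = g σ t) ∧ ∀ t, t ≠ 0 → g τ₂ t = g σ t) :
    (m + 2).factorial ≤ 2 * S.card := by
  obtain ⟨σ, hσ⟩ := hS
  obtain ⟨j, rfl⟩ : ∃ j, m = j + 1 := ⟨m - 1, by omega⟩
  refine (factorial_le_two_mul_card_agreeAbove hcov hmid hbot j (by omega) σ hσ).trans
    (Nat.mul_le_mul_left _ (Finset.card_le_card ?_))
  exact fun τ hτ => (mem_agreeAbove.1 hτ).1

end Combinatorics

/-! ### Independence in exterior powers -/

section ExteriorPower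

variable {K V W : Type*} [Field K] [AddCommGroup V] [Module K V] [AddCommGroup W] [Module K W]

theorem exteriorPower_subsingleton_of_finrank_lt [FiniteDimensional K V] {k : ℕ}
    (h : finrank K V < k) : Subsingleton (⋀[K]^k V) := by
  rw [← finrank_zero_iff (R := K), exteriorPower.finrank_eq, Nat.choose_eq_zero_of_lt h]

/-- The `k`-th exterior power of a linear map of rank less than `k` vanishes. -/
theorem exteriorPower_map_eq_zero [FiniteDimensional K W] {k : ℕ} (f : V →ₗ[K] W)
    (h : finrank K (LinearMap.range f) < k) : exteriorPower.map k f = 0 := by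
  have := exteriorPower_subsingleton_of_finrank_lt h
  have hf : f = (LinearMap.range f).subtype ∘ₗ f.rangeRestrict := rfl
  rw [hf, exteriorPower.map_comp]
  ext x
  simp [Subsingleton.elim ((exteriorPower.map k f.rangeRestrict) (exteriorPower.ιMulti K k x)) 0]

/-- The lines in `⋀ᵏ V` defined by two different subspaces of dimension `k` are independent. -/
theorem exteriorPower_map_subtype_add_ne_zero [FiniteDimensional K V] {k : ℕ}
    {A B : Submodule K V} (hA : finrank K A = k) (hB : finrank K B = k) (hAB : A ≠ B)
    {x : ⋀[K]^k A} {y : ⋀[K]^k B} (hx : x ≠ 0) :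
    exteriorPower.map k A.subtype x + exteriorPower.map k B.subtype y ≠ 0 := by
  intro h
  obtain ⟨v, hvB, hvA⟩ : ∃ v ∈ B, v ∉ A := by
    by_contra! hle
    exact hAB (Submodule.eq_of_le_of_finrank_eq hle (hB.trans hA.symm)).symm
  -- Project onto `A` along a complement containing `v ∈ B`. This is the identity on `A` but has
  -- rank less than `k` on `B`, so only `x` survives on `⋀ᵏ`.
  have hdis : Disjoint (Submodule.span K {v}) A := by
    have hv0 : v ≠ 0 := fun h0 => hvA (h0 ▸ A.zero_mem)
    exact ((Submodule.disjoint_span_singleton' hv0).2 hvA).symm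
  obtain ⟨C, hvC, hC⟩ := hdis.exists_isCompl
  let f := Submodule.projectionOnto A C hC.symm
  have hfA : f ∘ₗ A.subtype = LinearMap.id := by
    ext a
    simp [f]
  have hfv : f v = 0 := by
    exact (Submodule.projectionOnto_apply_eq_zero_iff _).2 <| hvC (Submodule.mem_span_singleton_self v)
  have hfB : exteriorPower.map k (f ∘ₗ B.subtype) = 0 := by
    apply exteriorPower_map_eq_zero
    have hker : 0 < finrank K (LinearMap.ker (f ∘ₗ B.subtype)) := by
      rw [Module.finrank_pos_iff_exists_ne_zero]
      refine ⟨⟨⟨v, hvB⟩, hfv⟩, fun h0 => hvA ?_⟩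
      have : v = 0 := congrArg (fun z => ((z : LinearMap.ker (f ∘ₗ B.subtype)) : B).1) h0
      exact this ▸ A.zero_mem
    have := LinearMap.finrank_range_add_finrank_ker (f ∘ₗ B.subtype)
    omega
  have h' := congrArg (exteriorPower.map k f) h
  rw [map_add, map_zero, ← LinearMap.comp_apply, ← LinearMap.comp_apply, ← exteriorPower.map_comp,
    ← exteriorPower.map_comp, hfA, hfB, exteriorPower.map_id] at h'
  simp at h'
  exact hx h'

theorem exteriorPower_ιMulti_ne_zero {k : ℕ} {v : Fin k → V} (hv : LinearIndependent K v) :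
    exteriorPower.ιMulti K k v ≠ 0 := by
  have h := (exteriorPower.ιMulti_family_linearIndependent_field (n := k) hv).ne_zero
    (Set.powersetCard.ofFinEmbEquiv (RelEmbedding.refl _))
  simpa [exteriorPower.ιMulti_family] using h

end ExteriorPower

/-! ### Coefficients viewed inside `⋀ᵏ V` -/

section Ambient

variable {K V : Type*} [Field K] [AddCommGroup V] [Module K V]

/-- The embedding of the coefficients `⋀ᵏ 𝔤(σ)` into `⋀ᵏ V`. -/
def ambient (k : ℕ) (σ : OrderComplex (Vertex K V)) :
    ((lusztig K V).extPower k).obj σ →ₗ[K] ⋀[K]^k V :=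
  exteriorPower.map k (bottom σ).subtype

theorem ambient_injective (k : ℕ) (σ : OrderComplex (Vertex K V)) :
    Function.Injective (ambient k σ) :=
  exteriorPower.map_injective_field (Submodule.subtype_injective _)

theorem ambient_map {k : ℕ} {σ τ : OrderComplex (Vertex K V)} (h : σ.1 ⊆ τ.1)
    (x : ((lusztig K V).extPower k).obj τ) :
    ambient k σ (((lusztig K V).extPower k).map h x) = ambient k τ x := by
  change (exteriorPower.map k (bottom σ).subtype ∘ₗ
    exteriorPower.map k (Submodule.inclusion (Finset.inf_mono h))) x = _
  rw [← exteriorPower.map_comp]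
  rfl

variable [Finite K] [FiniteDimensional K V]

open Classical in
-- The connecting maps are induced by inclusions, so they disappear in `⋀ᵏ V`, where coefficients at
-- different simplices can be compared.
theorem ambient_boundary {k : ℕ} {p r : ℤ} (c : ((lusztig K V).extPower k).Chain p)
    (σ : Simplex (Vertex K V) r) :
    ambient k σ.1 (((lusztig K V).extPower k).boundary p r c σ) =
      ∑ τ : Simplex (Vertex K V) p, ∑ s ∈ τ.1.1, if σ.1.1 = τ.1.1.erase s then
        ((-1 : K) ^ (τ.1.1.filter (· < s)).card) • ambient k τ.1 (c τ) else 0 := by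
  simp only [LocalSystem.boundary, LinearMap.coe_mk, AddHom.coe_mk, map_sum]
  refine Finset.sum_congr rfl fun τ _ => Finset.sum_congr rfl fun s _ => ?_
  split_ifs with h h' h'
  · rw [map_smul, ambient_map]
  · exact absurd (by convert h) h'
  · exact absurd (by convert h') h
  · rw [map_zero]

end Ambient

/-! ### Dimensions of the members of a flag -/

section Flags

variable {K V : Type*} [Field K] [AddCommGroup V] [Module K V]

theorem bottom_le {σ : OrderComplex (Vertex K V)} {U : Vertex K V} (hU : U ∈ σ.1) :
    bottom σ ≤ U.1 :=
  Finset.inf_le (f := Subtype.val) hU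

theorem card_add_eq {k : ℕ} (σ : Simplex (Vertex K V) (degD K V k)) :
    σ.1.1.card + k = finrank K V := by
  have := σ.2
  simp only [degD] at this
  omega

variable [FiniteDimensional K V]

theorem eq_of_mem_of_finrank_eq {σ : OrderComplex (Vertex K V)} {U W : Vertex K V}
    (hU : U ∈ σ.1) (hW : W ∈ σ.1) (h : finrank K U.1 = finrank K W.1) : U = W := by
  rcases σ.2.total hU hW with hle | hle
  · exact Subtype.ext (Submodule.eq_of_le_of_finrank_eq hle h)
  · exact (Subtype.ext (Submodule.eq_of_le_of_finrank_eq hle h.symm)).symm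

theorem image_finrank_subset (σ : OrderComplex (Vertex K V)) {k : ℕ}
    (hk : k ≤ finrank K (bottom σ)) :
    σ.1.image (fun U => finrank K U.1) ⊆ Finset.Ico k (finrank K V) := by
  intro d hd
  obtain ⟨U, hU, rfl⟩ := Finset.mem_image.1 hd
  exact Finset.mem_Ico.2 ⟨hk.trans (Submodule.finrank_mono (bottom_le hU)),
    Submodule.finrank_lt U.2.2⟩

theorem card_image_finrank (σ : OrderComplex (Vertex K V)) :
    (σ.1.image (fun U => finrank K U.1)).card = σ.1.card :=
  Finset.card_image_of_injOn fun _ hU _ hW h => eq_of_mem_of_finrank_eq hU hW h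

/-- The members have distinct dimensions, all at least that of `bottom σ` and below `dim V`. -/
theorem card_add_finrank_bottom_le (σ : OrderComplex (Vertex K V)) :
    σ.1.card + finrank K (bottom σ) ≤ finrank K V := by
  have h := Finset.card_le_card (image_finrank_subset σ le_rfl)
  rw [card_image_finrank, Nat.card_Ico] at h
  have := Submodule.finrank_le (bottom σ)
  omega

theorem finrank_bottom_of_card {σ : OrderComplex (Vertex K V)} {k : ℕ}
    (hc : σ.1.card + k = finrank K V) (hk : k ≤ finrank K (bottom σ)) :
    finrank K (bottom σ) = k := by
  have := card_add_finrank_bottom_le σ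
  omega

/-- Pigeonhole: `dim V - k` distinct dimensions fill the whole interval from `k` to `dim V - 1`. -/
theorem exists_mem_finrank_eq {σ : OrderComplex (Vertex K V)} {k d : ℕ}
    (hc : σ.1.card + k = finrank K V) (hk : k ≤ finrank K (bottom σ)) (hd : k ≤ d)
    (hd' : d < finrank K V) : ∃ U ∈ σ.1, finrank K U.1 = d := by
  have h := Finset.eq_of_subset_of_card_le (image_finrank_subset σ hk)
    (by rw [card_image_finrank, Nat.card_Ico]; omega)
  have hmem : d ∈ σ.1.image (fun U => finrank K U.1) := h ▸ Finset.mem_Ico.2 ⟨hd, hd'⟩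
  simpa using hmem

open Classical in
/-- The member of dimension `k + j` of a flag, or `V` if there is none. -/
def level (k : ℕ) (σ : OrderComplex (Vertex K V)) (j : ℕ) : Submodule K V :=
  σ.1.inf fun U => if finrank K U.1 = k + j then U.1 else ⊤

theorem level_eq {k j : ℕ} {σ : OrderComplex (Vertex K V)} {U : Vertex K V} (hU : U ∈ σ.1)
    (h : finrank K U.1 = k + j) : level k σ j = U.1 := by
  apply le_antisymm
  · simpa [h, level] using
      Finset.inf_le (f := fun U : Vertex K V => if finrank K U.1 = k + j then U.1 else ⊤) hU
  · refine Finset.le_inf fun W hW => ?_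
    split_ifs with hW'
    · rw [eq_of_mem_of_finrank_eq hU hW (h.trans hW'.symm)]
    · exact le_top

theorem level_eq_top {k j : ℕ} (σ : OrderComplex (Vertex K V)) (h : finrank K V ≤ k + j) :
    level k σ j = ⊤ := by
  refine (Finset.inf_congr rfl fun U _ => if_neg ?_).trans (Finset.inf_top _)
  have := Submodule.finrank_lt U.2.2
  omega

theorem level_zero {k : ℕ} {σ : OrderComplex (Vertex K V)} (hc : σ.1.card + k = finrank K V)
    (hk : k ≤ finrank K (bottom σ)) (hkn : k < finrank K V) : level k σ 0 = bottom σ := by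
  obtain ⟨U, hU, hUk⟩ := exists_mem_finrank_eq hc hk le_rfl hkn
  rw [level_eq (j := 0) hU hUk]
  exact (Submodule.eq_of_le_of_finrank_eq (bottom_le hU)
    ((finrank_bottom_of_card hc hk).trans hUk.symm)).symm

theorem level_covBy {k j : ℕ} {σ : OrderComplex (Vertex K V)} (hc : σ.1.card + k = finrank K V)
    (hk : k ≤ finrank K (bottom σ)) (hj : k + j < finrank K V) :
    level k σ j ⋖ level k σ (j + 1) := by
  obtain ⟨U, hU, hUk⟩ := exists_mem_finrank_eq hc hk (by omega) hj
  rw [level_eq hU hUk]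
  suffices h : U.1 ≤ level k σ (j + 1) ∧ finrank K (level k σ (j + 1)) = k + j + 1 by
    refine ⟨lt_of_le_of_ne h.1 fun he => ?_, fun C h₁ h₂ => ?_⟩
    · rw [← he] at h
      omega
    · have := Submodule.finrank_lt_finrank_of_lt h₁
      have := Submodule.finrank_lt_finrank_of_lt h₂
      omega
  -- At the last level the default value `⊤` of `level` supplies the cover of the hyperplane.
  rcases Nat.lt_or_ge (k + j + 1) (finrank K V) with hlt | hge
  · obtain ⟨W, hW, hWk⟩ := exists_mem_finrank_eq hc hk (by omega) hlt
    rw [level_eq (j := j + 1) hW hWk]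
    refine ⟨(σ.2.total hU hW).resolve_right fun hle => ?_, hWk⟩
    have := Submodule.finrank_mono (Subtype.coe_le_coe.2 hle)
    omega
  · rw [level_eq_top σ (j := j + 1) hge, finrank_top]
    exact ⟨le_top, by omega⟩

open Classical in
/-- Two maximal flags above dimension `k` with a common face differ in one level only. -/
theorem level_of_erase_eq {k j : ℕ} {σ τ : OrderComplex (Vertex K V)}
    (hσ : σ.1.card + k = finrank K V) (hσk : k ≤ finrank K (bottom σ))
    (hτk : k ≤ finrank K (bottom τ))
    {U s : Vertex K V} (hU : U ∈ σ.1) (hUj : finrank K U.1 = k + j) (hs : s ∈ τ.1)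
    (he : σ.1.erase U = τ.1.erase s) (hne : τ ≠ σ) :
    finrank K s.1 = k + j ∧ level k τ j ≠ level k σ j ∧
      ∀ t, t ≠ j → level k τ t = level k σ t := by
  -- Otherwise the member of `σ` with the dimension of `s` survives in the common face, and `τ` has
  -- two members of that dimension.
  have hsj : finrank K s.1 = k + j := by
    by_contra hsj
    obtain ⟨W, hW, hWs⟩ := exists_mem_finrank_eq hσ hσk
      (hτk.trans (Submodule.finrank_mono (bottom_le hs))) (Submodule.finrank_lt s.2.2)
    have hWU : W ≠ U := fun h => hsj (by rw [← hWs, h, hUj])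
    have hW' : W ∈ τ.1.erase s := he ▸ Finset.mem_erase.2 ⟨hWU, hW⟩
    rw [Finset.mem_erase] at hW'
    exact hW'.1 (eq_of_mem_of_finrank_eq hW'.2 hs hWs)
  refine ⟨hsj, ?_, fun t ht => ?_⟩
  · rw [level_eq hs hsj, level_eq hU hUj]
    intro h
    apply hne
    apply Subtype.ext
    rw [← Finset.insert_erase hs, ← Finset.insert_erase hU, ← he, Subtype.ext h]
  · rcases Nat.lt_or_ge (k + t) (finrank K V) with hlt | hge
    · obtain ⟨W, hW, hWt⟩ := exists_mem_finrank_eq hσ hσk (by omega) hlt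
      have hWU : W ≠ U := fun h => ht (by rw [h, hUj] at hWt; omega)
      have hW' : W ∈ τ.1.erase s := he ▸ Finset.mem_erase.2 ⟨hWU, hW⟩
      rw [level_eq hW hWt, level_eq (Finset.mem_of_mem_erase hW') hWt]
    · rw [level_eq_top _ hge, level_eq_top _ hge]

end Flags

/-! ### Exchange properties of the support and the lower bound -/

section LowerBound

variable {K V : Type*} [Field K] [AddCommGroup V] [Module K V]

open Classical in
/-- The contribution of the simplex `τ` to the coefficient at `ρ` of the boundary of `c`. -/
def faceTerm {k : ℕ} {p : ℤ} (c : ((lusztig K V).extPower k).Chain p)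
    (ρ : Finset (Vertex K V)) (τ : Simplex (Vertex K V) p) : ⋀[K]^k V :=
  ∑ s ∈ τ.1.1, if ρ = τ.1.1.erase s then
    ((-1 : K) ^ (τ.1.1.filter (· < s)).card) • ambient k τ.1 (c τ) else 0

open Classical in
theorem faceTerm_eq {k : ℕ} {p : ℤ} (c : ((lusztig K V).extPower k).Chain p)
    {ρ : Finset (Vertex K V)} {τ : Simplex (Vertex K V) p} {s : Vertex K V} (hs : s ∈ τ.1.1)
    (hρ : ρ = τ.1.1.erase s) :
    faceTerm c ρ τ = ((-1 : K) ^ (τ.1.1.filter (· < s)).card) • ambient k τ.1 (c τ) := by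
  rw [faceTerm, Finset.sum_eq_single_of_mem s hs, if_pos hρ]
  intro t ht hts
  refine if_neg fun h => ?_
  have : s ∈ τ.1.1.erase t := Finset.mem_erase.2 ⟨hts.symm, hs⟩
  rw [← h, hρ] at this
  exact Finset.notMem_erase s _ this

open Classical in
theorem exists_of_faceTerm_ne_zero {k : ℕ} {p : ℤ} {c : ((lusztig K V).extPower k).Chain p}
    {ρ : Finset (Vertex K V)} {τ : Simplex (Vertex K V) p} (h : faceTerm c ρ τ ≠ 0) :
    c τ ≠ 0 ∧ ∃ s ∈ τ.1.1, ρ = τ.1.1.erase s := by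
  obtain ⟨s, hs, hne⟩ := Finset.exists_ne_zero_of_sum_ne_zero h
  have hρ : ρ = τ.1.1.erase s := by
    by_contra hρ
    exact hne (if_neg hρ)
  refine ⟨fun h0 => hne ?_, s, hs, hρ⟩
  rw [if_pos hρ, h0, map_zero, smul_zero]

variable [FiniteDimensional K V]

theorem le_finrank_bottom_of_ne_zero {k : ℕ} {σ : OrderComplex (Vertex K V)}
    {x : ((lusztig K V).extPower k).obj σ} (hx : x ≠ 0) : k ≤ finrank K (bottom σ) := by
  by_contra! h
  have : Subsingleton (⋀[K]^k (bottom σ)) := exteriorPower_subsingleton_of_finrank_lt h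
  exact hx (this.elim _ _)

variable [Finite K]

open Classical in
theorem sum_faceTerm_eq_zero {k : ℕ} {p : ℤ} {c : ((lusztig K V).extPower k).Chain p}
    (hc : c ∈ ((lusztig K V).extPower k).cycles p) (σ : Simplex (Vertex K V) p) {U : Vertex K V}
    (hU : U ∈ σ.1.1) : ∑ τ, faceTerm c (σ.1.1.erase U) τ = 0 := by
  let ρ : Simplex (Vertex K V) (p - 1) :=
    ⟨⟨σ.1.1.erase U, σ.1.2.mono (by simp)⟩, by
      have h := Finset.card_erase_add_one hU
      have := σ.2
      simp only
      omega⟩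
  have h : ((lusztig K V).extPower k).boundary p (p - 1) c ρ = 0 :=
    congrFun (LinearMap.mem_ker.1 hc) ρ
  have h' := ambient_boundary c ρ
  rw [h, map_zero] at h'
  exact h'.symm

/-- The exchange property of the support of a cycle in degree `n - k - 1`. -/
theorem exists_exchange {k : ℕ} {c : ((lusztig K V).extPower k).Chain (degD K V k)}
    (hc : c ∈ cyclesD K V k) {σ : Simplex (Vertex K V) (degD K V k)} (hσ : c σ ≠ 0) {j : ℕ}
    (hj : k + j < finrank K V) :
    ∃ τ, c τ ≠ 0 ∧ level k τ.1 j ≠ level k σ.1 j ∧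
      ∀ t, t ≠ j → level k τ.1 t = level k σ.1 t := by
  classical
  have hσk := le_finrank_bottom_of_ne_zero hσ
  obtain ⟨U, hU, hUj⟩ := exists_mem_finrank_eq (card_add_eq σ) hσk (Nat.le_add_right k j) hj
  obtain ⟨τ, hτσ, hτ⟩ : ∃ τ, τ ≠ σ ∧ faceTerm c (σ.1.1.erase U) τ ≠ 0 := by
    by_contra! h
    have hsum := sum_faceTerm_eq_zero hc σ hU
    rw [Finset.sum_eq_single σ (fun τ _ hτ => h τ hτ) (by simp), faceTerm_eq c hU rfl] at hsum
    have := (smul_eq_zero_iff_right (by simp)).1 hsum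
    exact hσ (ambient_injective k σ.1 (this.trans (map_zero _).symm))
  obtain ⟨hcτ, s, hs, he⟩ := exists_of_faceTerm_ne_zero hτ
  exact ⟨τ, hcτ, (level_of_erase_eq (card_add_eq σ) hσk
    (le_finrank_bottom_of_ne_zero hcτ) hU hUj hs he fun h => hτσ (Subtype.ext h)).2⟩

/-- The lowest member of a flag in the support of a cycle can be exchanged in two ways. -/
theorem exists_two_exchanges {k : ℕ} {c : ((lusztig K V).extPower k).Chain (degD K V k)}
    (hc : c ∈ cyclesD K V k) {σ : Simplex (Vertex K V) (degD K V k)} (hσ : c σ ≠ 0)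
    (hkn : k < finrank K V) :
    ∃ τ₁, c τ₁ ≠ 0 ∧ ∃ τ₂, c τ₂ ≠ 0 ∧ level k τ₁.1 0 ≠ level k σ.1 0 ∧
      level k τ₂.1 0 ≠ level k σ.1 0 ∧ level k τ₁.1 0 ≠ level k τ₂.1 0 ∧
      (∀ t, t ≠ 0 → level k τ₁.1 t = level k σ.1 t) ∧
      ∀ t, t ≠ 0 → level k τ₂.1 t = level k σ.1 t := by
  classical
  have hσk := le_finrank_bottom_of_ne_zero hσ
  obtain ⟨U, hU, hUj⟩ := exists_mem_finrank_eq (d := k + 0) (card_add_eq σ) hσk le_rfl hkn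
  have hsum := sum_faceTerm_eq_zero hc σ hU
  -- If `τ₁` were the only possible further contributor, the vanishing sum would have one or two
  -- nonzero terms. One is impossible by injectivity of `ambient`, two by independence of the lines.
  have main : ∀ τ₁, ∃ τ₂, τ₂ ≠ σ ∧ τ₂ ≠ τ₁ ∧ faceTerm c (σ.1.1.erase U) τ₂ ≠ 0 := by
    intro τ₁
    by_contra! h
    rw [← Finset.add_sum_erase _ _ (Finset.mem_univ σ), faceTerm_eq c hU rfl] at hsum
    have hc0 : ((-1 : K) ^ (σ.1.1.filter (· < U)).card) • c σ ≠ 0 := by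
      rw [Ne, smul_eq_zero_iff_right (by simp)]
      exact hσ
    by_cases hex : ∃ τ ≠ σ, faceTerm c (σ.1.1.erase U) τ ≠ 0
    · obtain ⟨τ, hτσ, hτ⟩ := hex
      have hτ₁ : τ = τ₁ := by
        by_contra hne
        exact hτ (h τ hτσ hne)
      subst hτ₁
      obtain ⟨hcτ, s, hs, he⟩ := exists_of_faceTerm_ne_zero hτ
      have hτk := le_finrank_bottom_of_ne_zero hcτ
      rw [Finset.sum_eq_single_of_mem τ (Finset.mem_erase.2 ⟨hτσ, Finset.mem_univ _⟩)
        (fun ρ hρ hρτ => h ρ (Finset.ne_of_mem_erase hρ) hρτ), faceTerm_eq c hs he,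
        ← map_smul, ← map_smul] at hsum
      refine exteriorPower_map_subtype_add_ne_zero (finrank_bottom_of_card (card_add_eq σ) hσk)
        (finrank_bottom_of_card (card_add_eq τ) hτk) ?_ hc0 hsum
      have hl := (level_of_erase_eq (card_add_eq σ) hσk hτk hU hUj hs he
        fun h => hτσ (Subtype.ext h)).2.1
      rw [level_zero (card_add_eq σ) hσk hkn, level_zero (card_add_eq τ) hτk hkn] at hl
      exact hl.symm
    · push Not at hex
      rw [Finset.sum_eq_zero fun τ hτ => hex τ (Finset.ne_of_mem_erase hτ), add_zero,
        ← map_smul] at hsum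
      exact hc0 (ambient_injective k σ.1 (hsum.trans (map_zero _).symm))
  -- With `σ` itself as the excluded flag this gives a first exchange; excluding that one gives a
  -- second.
  obtain ⟨τ₁, h₁σ, -, h₁⟩ := main σ
  obtain ⟨τ₂, h₂σ, h₂₁, h₂⟩ := main τ₁
  obtain ⟨hc₁, s₁, hs₁, he₁⟩ := exists_of_faceTerm_ne_zero h₁
  obtain ⟨hc₂, s₂, hs₂, he₂⟩ := exists_of_faceTerm_ne_zero h₂
  have l₁ := level_of_erase_eq (card_add_eq σ) hσk
    (le_finrank_bottom_of_ne_zero hc₁) hU hUj hs₁ he₁ fun h => h₁σ (Subtype.ext h)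
  have l₂ := level_of_erase_eq (card_add_eq σ) hσk
    (le_finrank_bottom_of_ne_zero hc₂) hU hUj hs₂ he₂ fun h => h₂σ (Subtype.ext h)
  have l₁₂ := level_of_erase_eq (card_add_eq τ₂) (le_finrank_bottom_of_ne_zero hc₂)
    (le_finrank_bottom_of_ne_zero hc₁) hs₂ l₂.1 hs₁ (he₂.symm.trans he₁)
    fun h => h₂₁ (Subtype.ext h).symm
  exact ⟨τ₁, hc₁, τ₂, hc₂, l₁.2.1, l₂.2.1, l₁₂.2.1, l₁.2.2, l₂.2.2⟩

theorem factorial_le_two_mul_ncard_supp {k : ℕ} (hkn : k < finrank K V)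
    {c : ((lusztig K V).extPower k).Chain (degD K V k)} (hc : c ∈ cyclesD K V k) (hc0 : c ≠ 0) :
    (finrank K V - k + 2).factorial ≤ 2 * (LocalSystem.supp c).ncard := by
  classical
  obtain ⟨σ, hσ⟩ := Function.ne_iff.1 hc0
  have hS : (LocalSystem.supp c) =
      ((Finset.univ.filter fun σ => c σ ≠ 0 : Finset (Simplex (Vertex K V) (degD K V k))) :
        Set (Simplex (Vertex K V) (degD K V k))) := by
    ext
    simp [LocalSystem.supp]
  rw [hS, Set.ncard_coe_finset]
  refine factorial_le_two_mul_card (g := fun σ => level k σ.1) (by omega)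
    ⟨σ, by simpa using hσ⟩ ?_ ?_ ?_
  · intro σ hσ j hj
    exact level_covBy (card_add_eq σ) (le_finrank_bottom_of_ne_zero (Finset.mem_filter.1 hσ).2)
      (by omega)
  · intro σ hσ j _ hj
    obtain ⟨τ, hτ, h⟩ := exists_exchange hc (Finset.mem_filter.1 hσ).2 (j := j) (by omega)
    exact ⟨τ, by simpa using hτ, h⟩
  · intro σ hσ
    obtain ⟨τ₁, h₁, τ₂, h₂, h⟩ := exists_two_exchanges hc (Finset.mem_filter.1 hσ).2 hkn
    exact ⟨τ₁, by simpa using h₁, τ₂, by simpa using h₂, h⟩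

end LowerBound

/-! ### Homology classes are cycles -/

section Uniqueness

variable {K V : Type*} [Field K] [Finite K] [AddCommGroup V] [Module K V] [FiniteDimensional K V]

/-- A simplex one degree higher has `n - k + 1` members, so its lowest member has dimension below
`k` and its coefficient group is zero. -/
theorem boundaries_degD_eq_bot (k : ℕ) :
    ((lusztig K V).extPower k).boundaries (degD K V k) = ⊥ := by
  rw [LinearMap.range_eq_bot]
  ext1 c
  have : c = 0 := by
    funext σ
    by_contra h
    have h₁ := le_finrank_bottom_of_ne_zero h
    have h₂ := card_add_finrank_bottom_le σ.1
    have h₃ := σ.2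
    simp only [degD] at h₃
    omega
  rw [this, map_zero, map_zero]

theorem homologyClass_bijective (k : ℕ) : Function.Bijective
    (LocalSystem.homologyClass _ : cyclesD K V k → D K V k) := by
  refine ⟨fun z z' h => ?_, Submodule.Quotient.mk_surjective _⟩
  have h' := (Submodule.Quotient.eq _).1 h
  rw [Submodule.submoduleOf, Submodule.mem_comap, boundaries_degD_eq_bot,
    Submodule.mem_bot] at h'
  exact sub_eq_zero.1 (Subtype.ext h')

theorem homologyClass_eq_zero_iff {k : ℕ} {z : cyclesD K V k} :
    (LocalSystem.homologyClass _ z : D K V k) = 0 ↔ z = 0 :=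
  (homologyClass_bijective k).1.eq_iff' rfl

end Uniqueness

open Equiv

/-! ### Points in general position and orderings -/

section Frames

/-- Points `p₀, …, p_{m+1}` in general position and their barycentric coordinates, modulo the span
of the linearly independent vectors `z`. -/
structure Frame (K V : Type*) [Field K] [AddCommGroup V] [Module K V] (κ m : ℕ) where
  p : Fin (m + 2) → V
  f : Fin (m + 2) → Dual K V
  z : Fin κ → V
  f_sub : ∀ a b c, f c (p a - p b) = (if a = c then 1 else 0) - (if b = c then 1 else 0)
  f_z : ∀ c i, f c (z i) = 0
  linearIndependent_z : LinearIndependent K z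

variable {K V : Type*} [Field K] [AddCommGroup V] [Module K V] {κ m : ℕ}

/-- The points are `0` and `m + 1` basis vectors, with the other basis vectors as `z`. Only
differences of points are evaluated, so the coordinate at the point `0` may be replaced by its
linear part, minus the sum of the others. -/
theorem exists_frame [FiniteDimensional K V] (h : finrank K V = κ + (m + 1)) :
    Nonempty (Frame K V κ m) := by
  let b : Basis (Fin κ ⊕ Fin (m + 1)) K V :=
    (finBasisOfFinrankEq K V h).reindex finSumFinEquiv.symm
  refine ⟨⟨Fin.cons 0 fun i => b (Sum.inr i),
    Fin.cons (-∑ i, b.coord (Sum.inr i)) fun i => b.coord (Sum.inr i), fun i => b (Sum.inl i),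
    ?_, ?_, b.linearIndependent.comp _ Sum.inl_injective⟩⟩
  · intro a b' c
    refine Fin.cases ?_ (fun c => ?_) c <;> refine Fin.cases ?_ (fun a => ?_) a <;>
      refine Fin.cases ?_ (fun b' => ?_) b' <;>
      simp [Finsupp.single_apply, Fin.succ_ne_zero, (Fin.succ_ne_zero _).symm]
  · intro c i
    refine Fin.cases ?_ (fun c => ?_) c <;> simp

namespace Frame

variable (F : Frame K V κ m)

/-- The subspace on which the coordinates outside `T` vanish. -/
def face (T : Finset (Fin (m + 2))) : Submodule K V :=
  ⨅ b, ⨅ (_ : b ∉ T), LinearMap.ker (F.f b)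

theorem mem_face {T : Finset (Fin (m + 2))} {x : V} :
    x ∈ F.face T ↔ ∀ b, b ∉ T → F.f b x = 0 := by
  simp [face, Submodule.mem_iInf]

theorem z_mem_face (T : Finset (Fin (m + 2))) (i : Fin κ) : F.z i ∈ F.face T :=
  F.mem_face.2 fun _ _ => F.f_z _ _

theorem sub_mem_face {T : Finset (Fin (m + 2))} {a b : Fin (m + 2)} (ha : a ∈ T) (hb : b ∈ T) :
    F.p a - F.p b ∈ F.face T := by
  rw [mem_face]
  intro c hc
  rw [F.f_sub, if_neg (by rintro rfl; exact hc ha), if_neg (by rintro rfl; exact hc hb), sub_zero]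

theorem f_sub_self {a b : Fin (m + 2)} (h : b ≠ a) : F.f a (F.p a - F.p b) = 1 := by
  rw [F.f_sub, if_pos rfl, if_neg h, sub_zero]

theorem face_mono {T T' : Finset (Fin (m + 2))} (h : T ⊆ T') : F.face T ≤ F.face T' :=
  fun _ hx => F.mem_face.2 fun b hb => F.mem_face.1 hx b fun hb' => hb (h hb')

/-- For `b ∈ T` outside `T'`, the coordinate at `b` vanishes on `F.face T'` but is `1` on `F.p b -
F.p a`; this needs a second point `a` of `T`. -/
theorem subset_of_face_le {T T' : Finset (Fin (m + 2))} (hT : T.Nontrivial)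
    (h : F.face T ≤ F.face T') : T ⊆ T' := by
  intro b hb
  by_contra hb'
  obtain ⟨a, ha, hab⟩ := hT.exists_ne b
  have := F.mem_face.1 (h (F.sub_mem_face hb ha)) b hb'
  rw [F.f_sub_self hab] at this
  exact one_ne_zero this

end Frame

/-- The elements of rank less than `t` in the ordering given by `r`. -/
def initial (r : Perm (Fin (m + 2))) (t : ℕ) : Finset (Fin (m + 2)) :=
  Finset.univ.filter fun a => (r a : ℕ) < t

theorem mem_initial {r : Perm (Fin (m + 2))} {t : ℕ} {a : Fin (m + 2)} :
    a ∈ initial r t ↔ (r a : ℕ) < t := by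
  simp [initial]

theorem symm_mem_initial {r : Perm (Fin (m + 2))} {t : ℕ} {x : Fin (m + 2)} :
    r.symm x ∈ initial r t ↔ (x : ℕ) < t := by
  simp [initial]

theorem initial_nontrivial (r : Perm (Fin (m + 2))) (t : ℕ) : (initial r (t + 2)).Nontrivial :=
  ⟨r.symm 0, symm_mem_initial.2 (by simp), r.symm 1, symm_mem_initial.2 (by simp), by simp⟩

theorem initial_swap_mul (r : Perm (Fin (m + 2))) {i j : Fin (m + 2)} {t : ℕ}
    (h : (i : ℕ) < t ↔ (j : ℕ) < t) : initial (swap i j * r) t = initial r t := by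
  ext a
  rw [mem_initial, mem_initial, Perm.mul_apply, swap_apply_def]
  split_ifs with h₁ h₂
  · rw [h₁, h]
  · rw [h₂, h]
  · rfl

/-- The initial segments of size at least `2` determine every rank from `2` on and leave only the
order of the first two elements open. -/
theorem eq_or_eq_swap_mul {r r' : Perm (Fin (m + 2))}
    (h : ∀ i < m, initial r (i + 2) = initial r' (i + 2)) : r' = r ∨ r' = swap 0 1 * r := by
  have key : ∀ a t, 2 ≤ t → ((r a : ℕ) < t ↔ (r' a : ℕ) < t) := by
    intro a t ht
    rcases Nat.lt_or_ge t (m + 2) with hlt | hge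
    · have := h (t - 2) (by omega)
      rw [Nat.sub_add_cancel ht] at this
      rw [← mem_initial, ← mem_initial, this]
    · have := (r a).2
      have := (r' a).2
      omega
  have hge : ∀ a, 2 ≤ (r a : ℕ) → r' a = r a := by
    intro a ha
    have h₁ := key a (r a) ha
    have h₂ := key a (r a + 1) (by omega)
    exact Fin.ext (by omega)
  have hlt : ∀ a, (r a : ℕ) < 2 → (r' a : ℕ) < 2 := fun a ha => (key a 2 le_rfl).1 ha
  have e₀ : r (r.symm 0) = 0 := r.apply_symm_apply 0
  have e₁ : r (r.symm 1) = 1 := r.apply_symm_apply 1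
  have v₀ := hlt (r.symm 0) (by rw [e₀]; simp)
  have v₁ := hlt (r.symm 1) (by rw [e₁]; simp)
  have hne : (r' (r.symm 0) : ℕ) ≠ r' (r.symm 1) := by
    intro hh
    have := r.symm.injective (r'.injective (Fin.ext hh))
    simp at this
  have hcase : ∀ a, a = r.symm 0 ∨ a = r.symm 1 ∨ 2 ≤ (r a : ℕ) := by
    intro a
    by_contra! hh
    have n₀ : (r a : ℕ) ≠ 0 := fun h0 => hh.1 (by
      rw [Equiv.eq_symm_apply]; exact Fin.ext h0)
    have n₁ : (r a : ℕ) ≠ 1 := fun h0 => hh.2.1 (by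
      rw [Equiv.eq_symm_apply]; exact Fin.ext (by simpa using h0))
    omega
  have z₀ : ((0 : Fin (m + 2)) : ℕ) = 0 := rfl
  have z₁ : ((1 : Fin (m + 2)) : ℕ) = 1 := rfl
  by_cases hz : (r' (r.symm 0) : ℕ) = 0
  · left
    ext a
    rcases hcase a with rfl | rfl | ha
    · rw [e₀, hz, z₀]
    · rw [e₁]; omega
    · rw [hge a ha]
  · right
    ext a
    rcases hcase a with rfl | rfl | ha
    · rw [Perm.mul_apply, e₀, swap_apply_left]; omega
    · rw [Perm.mul_apply, e₁, swap_apply_right]; omega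
    · rw [hge a ha, Perm.mul_apply, swap_apply_of_ne_of_ne]
      · intro h0; rw [h0] at ha; simp at ha
      · intro h0; rw [h0] at ha; simp at ha

/-! ### The flags of orderings and the minimal cycle -/

namespace Frame

variable (F : Frame K V κ m)

/-- The face of the initial segment of cardinality `i + 2` of an ordering. -/
def vert (r : Perm (Fin (m + 2))) (i : Fin m) : Vertex K V :=
  ⟨F.face (initial r (i + 2)), by
    intro h
    have hm := F.sub_mem_face (symm_mem_initial (r := r) (t := i + 2) (x := 0) |>.2 (by simp))
      (symm_mem_initial (r := r) (t := i + 2) (x := 1) |>.2 (by simp))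
    rw [h, Submodule.mem_bot] at hm
    have h1 := F.f_sub_self (a := r.symm 0) (b := r.symm 1) (by simp)
    rw [hm, map_zero] at h1
    exact zero_ne_one h1, by
    intro h
    have hm : F.p (r.symm (Fin.last _)) - F.p (r.symm 0) ∈ F.face (initial r (i + 2)) :=
      h ▸ Submodule.mem_top
    have h0 := F.mem_face.1 hm (r.symm (Fin.last _)) (by
      rw [symm_mem_initial, Fin.val_last]
      omega)
    rw [F.f_sub_self (by simp [Fin.ext_iff])] at h0
    exact one_ne_zero h0⟩

theorem vert_congr {r r' : Perm (Fin (m + 2))} {i : Fin m}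
    (h : initial r (i + 2) = initial r' (i + 2)) : F.vert r i = F.vert r' i :=
  Subtype.ext (congrArg F.face h)

theorem vert_strictMono (r : Perm (Fin (m + 2))) : StrictMono (F.vert r) := by
  intro i j hij
  refine lt_of_le_not_ge (F.face_mono fun a ha => ?_) fun hle => ?_
  · rw [mem_initial] at ha ⊢
    have : (i : ℕ) < j := hij
    omega
  · have h := F.subset_of_face_le (initial_nontrivial r j) hle
      (symm_mem_initial (r := r) (x := ⟨i + 2, by omega⟩) |>.2 (Nat.add_lt_add_right hij 2))
    rw [symm_mem_initial] at h
    simp at h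

open Classical in
/-- The flag attached to an ordering: its members are the faces of the initial segments of
cardinality `2, …, m + 1`. -/
def flag (r : Perm (Fin (m + 2))) : OrderComplex (Vertex K V) :=
  ⟨Finset.univ.image (F.vert r), by
    rw [Finset.coe_image, Finset.coe_univ, Set.image_univ]
    exact (F.vert_strictMono r).monotone.isChain_range⟩

open Classical in
theorem flag_val (r : Perm (Fin (m + 2))) : (F.flag r).1 = Finset.univ.image (F.vert r) := rfl

theorem card_flag (r : Perm (Fin (m + 2))) : (F.flag r).1.card = m := by
  rw [flag_val, Finset.card_image_of_injective _ (F.vert_strictMono r).injective,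
    Finset.card_univ, Fintype.card_fin]

/-- The flag attached to an ordering, as a simplex of dimension `m - 1`. -/
def simplex {d : ℤ} (hd : (m : ℤ) = d + 1) (r : Perm (Fin (m + 2))) : Simplex (Vertex K V) d :=
  ⟨F.flag r, by rw [card_flag, hd]⟩

theorem simplex_eq_iff {d : ℤ} (hd : (m : ℤ) = d + 1) {r r' : Perm (Fin (m + 2))} :
    F.simplex hd r' = F.simplex hd r ↔ r' = r ∨ r' = swap 0 1 * r := by
  classical
  constructor
  · intro h
    have h' : (F.flag r).1 = (F.flag r').1 :=
      (congrArg (fun σ : Simplex (Vertex K V) d => σ.1.1) h).symm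
    rw [flag_val, flag_val, ← Finset.coe_inj, Finset.coe_image, Finset.coe_image,
      Finset.coe_univ, Set.image_univ, Set.image_univ,
      StrictMono.range_inj (F.vert_strictMono r) (F.vert_strictMono r')] at h'
    refine eq_or_eq_swap_mul fun i hi => ?_
    have he : F.face (initial r (i + 2)) = F.face (initial r' (i + 2)) :=
      congrArg Subtype.val (congrFun h' ⟨i, hi⟩)
    exact (F.subset_of_face_le (initial_nontrivial r i) he.le).antisymm
      (F.subset_of_face_le (initial_nontrivial r' i) he.ge)
  · rintro (rfl | rfl)
    · rfl
    · refine Subtype.ext (Subtype.ext ?_)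
      change Finset.univ.image (F.vert _) = Finset.univ.image (F.vert _)
      congr 1
      funext i
      exact F.vert_congr (initial_swap_mul r (by simp))

theorem swap_mul_ne (r : Perm (Fin (m + 2))) : swap 0 1 * r ≠ r := by
  intro h
  have := mul_eq_right.1 h
  rw [swap_eq_one_iff] at this
  simp at this

/-- The exterior product of `v` with the vectors `z`. -/
def wedge (v : V) : ⋀[K]^(κ + 1) V := exteriorPower.ιMulti K (κ + 1) (Matrix.vecCons v F.z)

theorem wedge_sub (v w : V) : F.wedge (v - w) = F.wedge v - F.wedge w := by
  have h := congrArg (fun g => g F.z) (map_sub (exteriorPower.ιMulti K (κ + 1)).curryLeft v w)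
  exact h

/-- The term of the ordering `r` in the chain of the frame. -/
def term (r : Perm (Fin (m + 2))) : ⋀[K]^(κ + 1) V :=
  ((Perm.sign r : ℤ) : K) • F.wedge (F.p (r.symm 0))

open Classical in
/-- The values in `⋀ V` of the chain of the frame. -/
def ambientChain {d : ℤ} (hd : (m : ℤ) = d + 1) (σ : Simplex (Vertex K V) d) :
    ⋀[K]^(κ + 1) V :=
  ∑ r, if F.simplex hd r = σ then F.term r else 0

/-- Exactly two orderings share this flag, and their opposite signs turn two points into a
difference. The difference lies in the lowest member of the flag, although the separate points need
not. -/
theorem ambientChain_simplex {d : ℤ} (hd : (m : ℤ) = d + 1) (r : Perm (Fin (m + 2))) :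
    F.ambientChain hd (F.simplex hd r) =
      ((Perm.sign r : ℤ) : K) • F.wedge (F.p (r.symm 0) - F.p (r.symm 1)) := by
  classical
  have hfil : (Finset.univ.filter fun r' => F.simplex hd r' = F.simplex hd r) =
      {r, swap 0 1 * r} := by
    ext r'
    simp [F.simplex_eq_iff hd]
  rw [ambientChain, ← Finset.sum_filter, hfil, Finset.sum_pair (swap_mul_ne r).symm, term, term,
    Perm.sign_mul, Perm.sign_swap (by simp), wedge_sub, smul_sub, sub_eq_add_neg]
  congr 1
  have : (swap 0 1 * r).symm 0 = r.symm 1 := by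
    rw [Equiv.symm_apply_eq, Perm.mul_apply, apply_symm_apply, swap_apply_right]
  rw [this, neg_one_mul, Units.val_neg, Int.cast_neg]
  exact neg_smul ((Perm.sign r : ℤ) : K) (F.wedge _)

theorem mem_bottom_flag {r : Perm (Fin (m + 2))} {x : V}
    (h : ∀ t, x ∈ F.face (initial r (t + 2))) : x ∈ bottom (F.flag r) := by
  classical
  rw [bottom, Submodule.mem_finsetInf]
  intro U hU
  rw [flag_val, Finset.mem_image] at hU
  obtain ⟨i, -, rfl⟩ := hU
  exact h i

theorem ambientChain_mem_range {d : ℤ} (hd : (m : ℤ) = d + 1) (σ : Simplex (Vertex K V) d) :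
    ∃ x, ambient (κ + 1) σ.1 x = F.ambientChain hd σ := by
  classical
  by_cases h : ∃ r, F.simplex hd r = σ
  · obtain ⟨r, rfl⟩ := h
    have hz : ∀ i, F.z i ∈ bottom (F.flag r) :=
      fun i => F.mem_bottom_flag fun t => F.z_mem_face _ i
    have hp : F.p (r.symm 0) - F.p (r.symm 1) ∈ bottom (F.flag r) :=
      F.mem_bottom_flag fun t => F.sub_mem_face (symm_mem_initial.2 (by simp))
        (symm_mem_initial.2 (by simp))
    let x : ⋀[K]^(κ + 1) (bottom (F.flag r)) := ((Perm.sign r : ℤ) : K) •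
      exteriorPower.ιMulti K (κ + 1) (Matrix.vecCons ⟨_, hp⟩ fun i => ⟨F.z i, hz i⟩)
    refine ⟨x, ?_⟩
    rw [ambientChain_simplex]
    change exteriorPower.map (κ + 1) (bottom (F.flag r)).subtype x = _
    rw [map_smul, exteriorPower.map_apply_ιMulti, wedge]
    congr 2
    funext i
    refine Fin.cases ?_ (fun i => ?_) i <;> simp
  · push Not at h
    refine ⟨0, ?_⟩
    rw [map_zero, ambientChain, Finset.sum_eq_zero fun r _ => if_neg (h r)]

/-- The chain of the frame. -/
def chain {d : ℤ} (hd : (m : ℤ) = d + 1) : ((lusztig K V).extPower (κ + 1)).Chain d :=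
  fun σ => (F.ambientChain_mem_range hd σ).choose

theorem ambient_chain {d : ℤ} (hd : (m : ℤ) = d + 1) (σ : Simplex (Vertex K V) d) :
    ambient (κ + 1) σ.1 (F.chain hd σ) = F.ambientChain hd σ :=
  (F.ambientChain_mem_range hd σ).choose_spec

theorem chain_ne_zero {d : ℤ} (hd : (m : ℤ) = d + 1) : F.chain hd ≠ 0 := by
  intro h
  have h' := F.ambient_chain hd (F.simplex hd 1)
  rw [h, Pi.zero_apply, map_zero, ambientChain_simplex] at h'
  -- The functional `F.f 0` kills all `z` but takes the value `1` on `F.p 0 - F.p 1`.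
  have hind : LinearIndependent K
      (Matrix.vecCons (F.p 0 - F.p 1) F.z : Fin (κ + 1) → V) := by
    refine linearIndependent_finCons.2 ⟨F.linearIndependent_z, fun hm => ?_⟩
    have hle : Submodule.span K (Set.range F.z) ≤ LinearMap.ker (F.f 0) :=
      Submodule.span_le.2 (by rintro _ ⟨i, rfl⟩; exact F.f_z 0 i)
    have h0 : F.f 0 (F.p 0 - F.p 1) = 0 := hle hm
    rw [F.f_sub_self (by simp)] at h0
    exact one_ne_zero h0
  apply exteriorPower_ιMulti_ne_zero hind
  have h₁ : (1 : Perm (Fin (m + 2))).symm = 1 := rfl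
  simpa [wedge, h₁] using h'.symm

theorem exists_simplex_of_mem_supp {d : ℤ} (hd : (m : ℤ) = d + 1) {σ : Simplex (Vertex K V) d}
    (h : σ ∈ LocalSystem.supp (F.chain hd)) : ∃ r, F.simplex hd r = σ := by
  by_contra! hr
  apply h
  apply ambient_injective
  rw [ambient_chain, ambientChain, Finset.sum_eq_zero fun r _ => if_neg (hr r), map_zero]

/-- Each flag in the support comes from at least two of the `(m + 2)!` orderings. The reverse
inequality follows from the general lower bound. -/
theorem two_mul_ncard_supp_chain_le {d : ℤ} (hd : (m : ℤ) = d + 1) :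
    2 * (LocalSystem.supp (F.chain hd)).ncard ≤ (m + 2).factorial := by
  classical
  have h₁ : (LocalSystem.supp (F.chain hd)).ncard ≤ (Finset.univ.image (F.simplex hd)).card := by
    rw [← Set.ncard_coe_finset]
    refine Set.ncard_le_ncard (fun σ hσ => ?_) (Finset.finite_toSet _)
    simpa using F.exists_simplex_of_mem_supp hd hσ
  have h₂ : (Finset.univ.image (F.simplex hd)).card • 2 ≤
      (Finset.univ : Finset (Perm (Fin (m + 2)))).card := by
    rw [Finset.card_eq_sum_card_image (F.simplex hd) Finset.univ]
    refine Finset.card_nsmul_le_sum _ _ _ fun σ hσ => ?_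
    obtain ⟨r, -, rfl⟩ := Finset.mem_image.1 hσ
    refine (Finset.card_pair (swap_mul_ne r).symm).ge.trans
      (Finset.card_le_card fun r' hr' => ?_)
    simpa [F.simplex_eq_iff hd] using hr'
  rw [Finset.card_univ, Fintype.card_perm, Fintype.card_fin, smul_eq_mul] at h₂
  omega

theorem term_swap_mul (r : Perm (Fin (m + 2))) {i j : Fin (m + 2)} (hi : i ≠ 0) (hj : j ≠ 0)
    (hij : i ≠ j) : F.term (swap i j * r) = -F.term r := by
  have : (swap i j * r).symm 0 = r.symm 0 := by
    rw [Equiv.symm_apply_eq, Perm.mul_apply, apply_symm_apply,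
      swap_apply_of_ne_of_ne hi.symm hj.symm]
  rw [term, term, this, Perm.sign_mul, Perm.sign_swap hij, neg_one_mul, Units.val_neg,
    Int.cast_neg]
  exact neg_smul ((Perm.sign r : ℤ) : K) (F.wedge _)

open Classical in
-- Interchanging the points in positions `i + 1` and `i + 2` (counted from `0`) changes only the
-- initial segment of size `i + 2`, whose face is the member deleted.
theorem erase_flag_swap_mul (r : Perm (Fin (m + 2))) (i : Fin m) :
    (F.flag (swap i.succ.castSucc i.succ.succ * r)).1.erase
      (F.vert (swap i.succ.castSucc i.succ.succ * r) i) = (F.flag r).1.erase (F.vert r i) := by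
  rw [flag_val, flag_val, ← Finset.image_erase (F.vert_strictMono _).injective,
    ← Finset.image_erase (F.vert_strictMono _).injective]
  refine Finset.image_congr fun j hj => F.vert_congr (initial_swap_mul r ?_)
  have hj : j ≠ i := by simpa using hj
  have : (j : ℕ) ≠ i := fun h => hj (Fin.ext h)
  simp only [Fin.val_castSucc, Fin.val_succ]
  omega

open Classical in
theorem card_filter_lt_vert (r : Perm (Fin (m + 2))) (i : Fin m) :
    ((F.flag r).1.filter (· < F.vert r i)).card = i := by
  rw [flag_val, Finset.filter_image, Finset.card_image_of_injective _
    (F.vert_strictMono r).injective]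
  simp only [(F.vert_strictMono r).lt_iff_lt]
  rw [Finset.filter_gt_eq_Iio, Fin.card_Iio]

open Classical in
/-- The terms of a face cancel in pairs. -/
theorem sum_term_erase_eq_zero (ρ : Finset (Vertex K V)) (i : Fin m) :
    ∑ r, (if ρ = (F.flag r).1.erase (F.vert r i) then F.term r else 0) = 0 := by
  have hne : i.succ.castSucc ≠ i.succ.succ := by simp [Fin.ext_iff]
  refine Finset.sum_involution (fun r _ => swap i.succ.castSucc i.succ.succ * r) ?_ ?_ ?_ ?_
  · intro r _
    -- Position `0` is not moved, even for `i = 0`, so the first point stays and only the sign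
    -- changes.
    rw [erase_flag_swap_mul, F.term_swap_mul r (by simp [Fin.ext_iff]) (by simp) hne]
    split_ifs <;> simp
  · intro r _ _ h
    exact hne (swap_eq_one_iff.1 (mul_eq_right.1 h))
  · intro r _
    exact Finset.mem_univ _
  · intro r _
    rw [← mul_assoc, swap_mul_self, one_mul]

variable [Finite K] [FiniteDimensional K V]

theorem chain_mem_cycles {d : ℤ} (hd : (m : ℤ) = d + 1) :
    F.chain hd ∈ ((lusztig K V).extPower (κ + 1)).cycles d := by
  classical
  rw [LinearMap.mem_ker]
  funext ρ
  apply ambient_injective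
  rw [ambient_boundary, Pi.zero_apply, map_zero]
  simp only [ambient_chain]
  -- The contribution of a single ordering: regrouping the boundary by orderings and then by the
  -- position of the deleted member makes the cancellation termwise.
  let G (τ : Simplex (Vertex K V) d) (r : Perm (Fin (m + 2))) : ⋀[K]^(κ + 1) V :=
    ∑ s ∈ τ.1.1, if ρ.1.1 = τ.1.1.erase s then
      ((-1 : K) ^ (τ.1.1.filter (· < s)).card) • F.term r else 0
  calc _ = ∑ τ : Simplex (Vertex K V) d, ∑ r, if F.simplex hd r = τ then G τ r else 0 := by
        refine Finset.sum_congr rfl fun τ _ => ?_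
        trans ∑ s ∈ τ.1.1, ∑ r, if F.simplex hd r = τ then
          (if ρ.1.1 = τ.1.1.erase s then
            ((-1 : K) ^ (τ.1.1.filter (· < s)).card) • F.term r else 0) else 0
        · refine Finset.sum_congr rfl fun s _ => ?_
          split_ifs
          · simp only [ambientChain, Finset.smul_sum, smul_ite, smul_zero]
          · simp
        · rw [Finset.sum_comm]
          refine Finset.sum_congr rfl fun r _ => ?_
          split_ifs
          · rfl
          · exact Finset.sum_const_zero
    _ = ∑ r, G (F.simplex hd r) r := by
        rw [Finset.sum_comm]
        simp
    _ = ∑ r, ∑ i : Fin m, ((-1 : K) ^ (i : ℕ)) •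
          (if ρ.1.1 = (F.flag r).1.erase (F.vert r i) then F.term r else 0) := by
        refine Finset.sum_congr rfl fun r _ => ?_
        change ∑ s ∈ Finset.univ.image (F.vert r), (if ρ.1.1 = (F.flag r).1.erase s then
          ((-1 : K) ^ ((F.flag r).1.filter (· < s)).card) • F.term r else 0) = _
        rw [Finset.sum_image fun _ _ _ _ h => (F.vert_strictMono r).injective h]
        refine Finset.sum_congr rfl fun i _ => ?_
        rw [card_filter_lt_vert, smul_ite, smul_zero]
    _ = 0 := by
        rw [Finset.sum_comm]
        refine Finset.sum_eq_zero fun i _ => ?_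
        rw [← Finset.smul_sum, sum_term_erase_eq_zero, smul_zero]

end Frame

end Frames

end TwistedBuilding

end

theorem theorem1p6 {K V : Type*} [Field K] [Finite K] [AddCommGroup V] [Module K V]
    [FiniteDimensional K V] (n k : ℕ) (hn : Module.finrank K V = n) (hk : 1 ≤ k)
    (hkn : k + 1 ≤ n) :
    (∀ w : TwistedBuilding.D K V k, ∃! z : TwistedBuilding.cyclesD K V k,
      TwistedBuilding.LocalSystem.homologyClass _ z = w) ∧
    IsLeast {N : ℕ | ∃ z : TwistedBuilding.cyclesD K V k,
        (TwistedBuilding.LocalSystem.homologyClass _ z : TwistedBuilding.D K V k) ≠ 0 ∧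
        (TwistedBuilding.LocalSystem.supp z.1).ncard = N}
      ((n - k + 2).factorial / 2) := by
  subst hn
  have lower : ∀ z : TwistedBuilding.cyclesD K V k, z ≠ 0 →
      (Module.finrank K V - k + 2).factorial ≤
        2 * (TwistedBuilding.LocalSystem.supp z.1).ncard := fun z hz =>
    TwistedBuilding.factorial_le_two_mul_ncard_supp hkn z.2 fun h => hz (Subtype.ext h)
  refine ⟨fun w => (TwistedBuilding.homologyClass_bijective k).existsUnique w, ?_, ?_⟩
  -- Here `κ = k - 1` is the number of vectors `z`, and `m = n - k` the number of members of a flag.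
  · obtain ⟨κ, rfl⟩ : ∃ κ, k = κ + 1 := ⟨k - 1, by omega⟩
    obtain ⟨m, hm⟩ : ∃ m, Module.finrank K V = κ + (m + 1) :=
      ⟨Module.finrank K V - κ - 1, by omega⟩
    obtain ⟨F⟩ := TwistedBuilding.exists_frame hm
    have hd : (m : ℤ) = TwistedBuilding.degD K V (κ + 1) + 1 := by
      simp only [TwistedBuilding.degD]
      omega
    let z : TwistedBuilding.cyclesD K V (κ + 1) := ⟨F.chain hd, F.chain_mem_cycles hd⟩
    have hz : z ≠ 0 := fun h => F.chain_ne_zero hd (congrArg Subtype.val h)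
    refine ⟨z, fun h => hz (TwistedBuilding.homologyClass_eq_zero_iff.1 h), ?_⟩
    -- The two bounds give `2 * ncard = (m + 2)!`, so the division by `2` is exact.
    have h₁ := lower z hz
    have h₂ := F.two_mul_ncard_supp_chain_le hd
    rw [show Module.finrank K V - (κ + 1) + 2 = m + 2 by omega] at h₁ ⊢
    change (TwistedBuilding.LocalSystem.supp (F.chain hd)).ncard = _
    change _ ≤ 2 * (TwistedBuilding.LocalSystem.supp (F.chain hd)).ncard at h₁
    omega
  · rintro N ⟨z, hz, rfl⟩
    have := lower z fun h => hz (TwistedBuilding.homologyClass_eq_zero_iff.2 h)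
    omega
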